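/- Let $U$ be a finite set and let $\mathcal C\subseteq 2^U$ be a covering of $U$, i.e. $\bigcup_{K\in\mathcal C}K=U$. Let $M(\mathcal C)$ be the transversal matroid of $\mathcal C$ (its independent sets are the partial transversals of $\mathcal C$), and let $L(\mathcal C)$ be the lattice of closed sets (flats) of $M(\mathcal C)$ ordered by inclusion. For $x\in U$ put $\mathcal C(\{x\})=\{K\in\mathcal C: x\in K\}$ and $E(\{x\})=\{y\in U:\mathcal C(\{y\})\subseteq\mathcal C(\{x\})\}$, and let $\mathcal E=\{E(\{x\}) : x\in U,\ |\mathcal C(\{x\})|=2\}$. Call $\mathcal C$ reduced if any two elements $x,y\in U$ with $\mathcal C(\{x\})=\mathcal C(\{y\})$ and $|\mathcal C(\{x\})|=1$ are equal. Let $P_n$ be the lattice of partitions of an $n$-element set, ordered by refinement. If $P_n\cong L(\mathcal C)$, then $n\le 3$. Moreover, if $n=3$ and $\mathcal C$ is reduced, then $m=3$ and $k=1$, where $m=|U|$ and $k$ is the number of blocks of $\mathcal E$; that is, $|U|=3$, and $\mathcal E$ is a partition of $U$ with exactly one block. -/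

import Mathlib

namespace CoveringLattice

/-- `C` is a covering of the ground set `U`: a collection of subsets of `U` with union `U`. -/
def IsCovering {U : Type*} (C : Set (Set U)) : Prop :=
  ⋃₀ C = Set.univ

/-- `I` is a partial transversal of `C`: there are pairwise distinct members `f x` of `C`,
one for each `x ∈ I`, such that `x ∈ f x`. -/
def IsPartialTransversal {U : Type*} (C : Set (Set U)) (I : Set U) : Prop :=
  ∃ f : U → Set U, Set.InjOn f I ∧ ∀ x ∈ I, f x ∈ C ∧ x ∈ f x

theorem IsPartialTransversal.empty {U : Type*} (C : Set (Set U)) :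
    IsPartialTransversal C ∅ :=
  ⟨fun _ => ∅, by simp, by simp⟩

theorem IsPartialTransversal.subset {U : Type*} {C : Set (Set U)} ⦃I J : Set U⦄
    (hJ : IsPartialTransversal C J) (hIJ : I ⊆ J) : IsPartialTransversal C I := by
  obtain ⟨f, hf, hfC⟩ := hJ
  exact ⟨f, hf.mono hIJ, fun x hx => hfC x (hIJ hx)⟩

theorem IsPartialTransversal.augment {U : Type*} [Finite U] {C : Set (Set U)} ⦃I J : Set U⦄
    (hI : IsPartialTransversal C I) (hJ : IsPartialTransversal C J)
    (hlt : I.ncard < J.ncard) :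
    ∃ e ∈ J, e ∉ I ∧ IsPartialTransversal C (insert e I) := by
  classical
  obtain ⟨g, hg, hgC⟩ := hJ
  -- among all choices `f` for `I`, take one that agrees with `g` as often as possible
  let P : (U → Set U) → Prop := fun f => Set.InjOn f I ∧ ∀ x ∈ I, f x ∈ C ∧ x ∈ f x
  obtain ⟨f, hfP, hmax⟩ := Set.exists_max_image {f | P f}
    (fun f => {x | x ∈ I ∧ f x = g x}.ncard) (Set.toFinite _) hI
  obtain ⟨hf, hfC⟩ := hfP
  have hcard : (f '' I).ncard < (g '' J).ncard := by
    rwa [hf.ncard_image, hg.ncard_image]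
  obtain ⟨_, ⟨y, hyJ, rfl⟩, hy⟩ := Set.exists_mem_notMem_of_ncard_lt_ncard hcard
  have hne : ∀ x ∈ I, f x ≠ g y := fun x hx h => hy ⟨x, hx, h⟩
  have hinj : Set.InjOn (Function.update f y (g y)) (insert y I) := by
    intro a ha b hb hab
    by_cases hay : a = y <;> by_cases hby : b = y
    · rw [hay, hby]
    · have hbI : b ∈ I := hb.resolve_left hby
      subst hay
      rw [Function.update_self, Function.update_of_ne hby] at hab
      exact absurd hab.symm (hne b hbI)
    · have haI : a ∈ I := ha.resolve_left hay
      subst hby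
      rw [Function.update_self, Function.update_of_ne hay] at hab
      exact absurd hab (hne a haI)
    · rw [Function.update_of_ne hay, Function.update_of_ne hby] at hab
      exact hf (ha.resolve_left hay) (hb.resolve_left hby) hab
  have hmem : ∀ x ∈ insert y I,
      Function.update f y (g y) x ∈ C ∧ x ∈ Function.update f y (g y) x := by
    intro x hx
    by_cases hxy : x = y
    · subst hxy
      rw [Function.update_self]
      exact hgC x hyJ
    · rw [Function.update_of_ne hxy]
      exact hfC x (hx.resolve_left hxy)
  refine ⟨y, hyJ, fun hyI => ?_, _, hinj, hmem⟩
  have hle := hmax (Function.update f y (g y))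
    ⟨hinj.mono (Set.subset_insert y I), fun x hx => hmem x (Set.mem_insert_of_mem y hx)⟩
  refine absurd hle (not_le.2 (Set.ncard_lt_ncard ?_ (Set.toFinite _)))
  refine (Set.ssubset_iff_of_subset ?_).2 ⟨y, ⟨hyI, Function.update_self ..⟩, fun h => hne y hyI h.2⟩
  rintro x ⟨hxI, hx⟩
  have hxy : x ≠ y := by
    rintro rfl
    exact hne x hxI hx
  exact ⟨hxI, by rw [Function.update_of_ne hxy, hx]⟩

/-- The transversal matroid `M(C)` on the finite ground set `U`: its independent sets are the
partial transversals of `C`. -/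
def transversalMatroid {U : Type*} [Finite U] (C : Set (Set U)) : Matroid U :=
  (IndepMatroid.ofFinite (E := Set.univ) Set.finite_univ (IsPartialTransversal C)
    (IsPartialTransversal.empty C) IsPartialTransversal.subset IsPartialTransversal.augment
    (fun _ _ => Set.subset_univ _)).matroid

theorem transversalMatroid_indep_iff {U : Type*} [Finite U] (C : Set (Set U)) (I : Set U) :
    (transversalMatroid C).Indep I ↔ IsPartialTransversal C I := by
  simp [transversalMatroid]

theorem transversalMatroid_ground {U : Type*} [Finite U] (C : Set (Set U)) :
    (transversalMatroid C).E = Set.univ := rfl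

/-- The lattice `L(C)` induced by `C`: the closed sets (flats) of `M(C)`, ordered by inclusion. -/
abbrev L {U : Type*} [Finite U] (C : Set (Set U)) : Type _ :=
  {F : Set U // (transversalMatroid C).IsFlat F}

/-- The partition lattice `P_n`: all partitions of an `n`-element set into nonempty blocks,
ordered by refinement (Mathlib's order on `Finpartition`). -/
abbrev P (n : ℕ) : Type :=
  Finpartition (Finset.univ : Finset (Fin n))

/-- `C(H)`: the members of `C` that meet `H`. -/
def meeting {U : Type*} (C : Set (Set U)) (H : Set U) : Set (Set U) :=
  {K | K ∈ C ∧ (K ∩ H).Nonempty}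

/-- The relation `x ∼ y` on `U`. -/
def Sim {U : Type*} (C : Set (Set U)) (x y : U) : Prop :=
  x = y ∨ (meeting C {x} = meeting C {y} ∧ (meeting C {x}).ncard = 1)

/-- `C` is reduced: the classes of `∼` are singletons. -/
def IsReduced {U : Type*} (C : Set (Set U)) : Prop :=
  ∀ x y : U, Sim C x y → x = y

/-- `E({x}) = {y ∈ U : C({y}) ⊆ C({x})}`. -/
def E {U : Type*} (C : Set (Set U)) (x : U) : Set U :=
  {y | meeting C {y} ⊆ meeting C {x}}

/-- The family of all sets `E({x})` with `|C({x})| = 2`. -/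
def familyE {U : Type*} (C : Set (Set U)) : Set (Set U) :=
  {S | ∃ x : U, (meeting C {x}).ncard = 2 ∧ S = E C x}

end CoveringLattice

/-! Under the isomorphism, each pair `i, j` gives an atom of the lattice of flats, hence an element
of `U`. Transitivity makes the elements for `ij`, `ik`, `jk` a triangle of `M(C)`
(`Represents.isTriangle`). By Hall's theorem a triangle meets exactly two members of `C`, and one of
its elements lies in both (`IsTriangle.exists_meeting_eq`).

If there is a fourth point `l`, say that element represents `ij`. Then the triangle on `i, j, l`
meets the same two members, so the elements for `ij`, `ik`, `il` meet only two members and are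
dependent. But a star of three pairs is independent, so `n ≤ 3`.

For `n = 3`, reducedness identifies parallel elements, so `U` is a single triangle; the element
lying in both members has `E` equal to all of `U`. -/

namespace CoveringLattice

/-! ### Hall's condition and the small circuits of a transversal matroid. -/

section Hall

variable {U : Type*} {C : Set (Set U)}

theorem meeting_mono (C : Set (Set U)) {H H' : Set U} (h : H ⊆ H') :
    meeting C H ⊆ meeting C H' :=
  fun _ hK => ⟨hK.1, hK.2.mono (Set.inter_subset_inter_right _ h)⟩

theorem mem_meeting_singleton {K : Set U} {x : U} : K ∈ meeting C {x} ↔ K ∈ C ∧ x ∈ K := by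
  simp [meeting]

theorem mem_meeting_iff {K H : Set U} : K ∈ meeting C H ↔ ∃ x ∈ H, K ∈ meeting C {x} := by
  simp only [mem_meeting_singleton]
  constructor
  · rintro ⟨hK, x, hxK, hxH⟩
    exact ⟨x, hxH, hK, hxK⟩
  · rintro ⟨x, hxH, hK, hxK⟩
    exact ⟨hK, x, hxK, hxH⟩

theorem meeting_insert (C : Set (Set U)) (x : U) (H : Set U) :
    meeting C (insert x H) = meeting C {x} ∪ meeting C H := by
  ext K
  rw [mem_meeting_iff, Set.mem_union, mem_meeting_iff (H := H)]
  simp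

theorem isPartialTransversal_singleton (hC : IsCovering C) (x : U) :
    IsPartialTransversal C {x} := by
  have hx : x ∈ ⋃₀ C := by rw [hC]; trivial
  obtain ⟨K, hK, hxK⟩ := hx
  exact ⟨fun _ => K, by simp, by simpa using ⟨hK, hxK⟩⟩

variable [Finite U]

theorem IsPartialTransversal.ncard_le {I : Set U} (hI : IsPartialTransversal C I) :
    I.ncard ≤ (meeting C I).ncard := by
  obtain ⟨f, hf, hfC⟩ := hI
  rw [← hf.ncard_image]
  refine Set.ncard_le_ncard ?_ (Set.toFinite _)
  rintro _ ⟨x, hx, rfl⟩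
  exact ⟨(hfC x hx).1, x, (hfC x hx).2, hx⟩

theorem isPartialTransversal_of_forall_ncard_le {I : Set U}
    (h : ∀ J ⊆ I, J.ncard ≤ (meeting C J).ncard) : IsPartialTransversal C I := by
  classical
  let t : I → Finset (Set U) := fun x => (Set.toFinite (meeting C {x.1})).toFinset
  have ht : ∀ x K, K ∈ t x ↔ K ∈ meeting C {x.1} := fun x K => Set.Finite.mem_toFinset _
  obtain ⟨f, hf, hft⟩ :=
    (Finset.all_card_le_biUnion_card_iff_exists_injective t).1 fun s => by
      have hs := h (Subtype.val '' (s : Set I)) (by rintro _ ⟨x, -, rfl⟩; exact x.2)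
      rw [Set.ncard_image_of_injective _ Subtype.val_injective, Set.ncard_coe_finset] at hs
      refine hs.trans ?_
      rw [← Set.ncard_coe_finset]
      refine Set.ncard_le_ncard ?_ (Set.toFinite _)
      intro K hK
      obtain ⟨_, ⟨x, hx, rfl⟩, hK⟩ := mem_meeting_iff.1 hK
      exact Finset.mem_coe.2 (Finset.mem_biUnion.2 ⟨x, hx, (ht x K).2 hK⟩)
  refine ⟨fun x => if hx : x ∈ I then f ⟨x, hx⟩ else ∅, ?_, ?_⟩
  · intro x hx y hy hxy
    simp only [hx, hy, dite_true] at hxy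
    exact congrArg Subtype.val (hf hxy)
  · intro x hx
    simp only [hx, dite_true]
    exact mem_meeting_singleton.1 ((ht _ _).1 (hft ⟨x, hx⟩))

/-- A circuit of `M(C)` meets fewer members of `C` than it has elements. -/
theorem ncard_meeting_lt {I : Set U} (hI : ¬ IsPartialTransversal C I)
    (h : ∀ x ∈ I, IsPartialTransversal C (I \ {x})) : (meeting C I).ncard < I.ncard := by
  by_contra! hle
  refine hI (isPartialTransversal_of_forall_ncard_le fun J hJ => ?_)
  by_cases hIJ : I ⊆ J
  · rwa [hJ.antisymm hIJ]
  · obtain ⟨x, hxI, hxJ⟩ := Set.not_subset.1 hIJ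
    exact ((h x hxI).subset fun y hy => ⟨hJ hy, fun hyx => hxJ (hyx ▸ hy)⟩).ncard_le

/-- A covering has no loops, so a dependent pair of distinct elements is a circuit. It meets fewer
than two members, while each element meets at least one. -/
theorem sim_of_not_isPartialTransversal (hC : IsCovering C) {x y : U}
    (h : ¬ IsPartialTransversal C {x, y}) : Sim C x y := by
  by_cases hxy : x = y
  · exact Or.inl hxy
  have hx := (isPartialTransversal_singleton hC x).ncard_le
  have hy := (isPartialTransversal_singleton hC y).ncard_le
  have hlt := ncard_meeting_lt h (by
    rintro z (rfl | rfl)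
    · exact (isPartialTransversal_singleton hC y).subset (by intro; simp; tauto)
    · exact (isPartialTransversal_singleton hC x).subset (by intro; simp; tauto))
  rw [Set.ncard_pair hxy] at hlt
  rw [Set.ncard_singleton] at hx hy
  have hxs : meeting C {x} = meeting C {x, y} :=
    Set.eq_of_subset_of_ncard_le (meeting_mono C (by simp)) (by omega) (Set.toFinite _)
  have hys : meeting C {y} = meeting C {x, y} :=
    Set.eq_of_subset_of_ncard_le (meeting_mono C (by simp)) (by omega) (Set.toFinite _)
  exact Or.inr ⟨hxs.trans hys.symm, by
    have := congrArg Set.ncard hxs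
    omega⟩

/-- The structure of a triangle (three-element circuit) of `M(C)`. -/
structure IsTriangle (C : Set (Set U)) (a b c : U) : Prop where
  ne₁₂ : a ≠ b
  ne₁₃ : a ≠ c
  ne₂₃ : b ≠ c
  indep₁₂ : IsPartialTransversal C {a, b}
  indep₁₃ : IsPartialTransversal C {a, c}
  indep₂₃ : IsPartialTransversal C {b, c}
  dep : ¬ IsPartialTransversal C {a, b, c}

theorem IsTriangle.ncard_meeting {a b c : U} (h : IsTriangle C a b c) :
    (meeting C {a, b, c}).ncard = 2 := by
  have hlt := ncard_meeting_lt h.dep (by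
    rintro z (rfl | rfl | rfl)
    · exact h.indep₂₃.subset (by intro; simp; tauto)
    · exact h.indep₁₃.subset (by intro; simp; tauto)
    · exact h.indep₁₂.subset (by intro; simp; tauto))
  rw [Set.ncard_eq_three.2 ⟨a, b, c, h.ne₁₂, h.ne₁₃, h.ne₂₃, rfl⟩] at hlt
  have h2 := h.indep₂₃.ncard_le
  rw [Set.ncard_pair h.ne₂₃] at h2
  have := h2.trans (Set.ncard_le_ncard (meeting_mono C (Set.subset_insert a _)) (Set.toFinite _))
  omega

theorem meeting_ne_of_isPartialTransversal {a b : U} (hab : a ≠ b)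
    (h : IsPartialTransversal C {a, b}) {K : Set U} (ha : meeting C {a} = {K}) :
    meeting C {b} ≠ {K} := by
  intro hb
  have := h.ncard_le
  rw [Set.ncard_pair hab, meeting_insert, ha, hb, Set.union_self, Set.ncard_singleton] at this
  omega

/-- Otherwise each element lies in a single member; independence of the pairs makes these three
members distinct, but a triangle meets only two. -/
theorem IsTriangle.exists_meeting_eq (hC : IsCovering C) {a b c : U} (h : IsTriangle C a b c) :
    meeting C {a} = meeting C {a, b, c} ∨ meeting C {b} = meeting C {a, b, c} ∨
      meeting C {c} = meeting C {a, b, c} := by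
  have key : ∀ x ∈ ({a, b, c} : Set U), meeting C {x} = meeting C {a, b, c} ∨
      ∃ K, meeting C {x} = {K} := by
    intro x hx
    have hsub : meeting C {x} ⊆ meeting C {a, b, c} :=
      meeting_mono C (Set.singleton_subset_iff.2 hx)
    by_cases h2 : 2 ≤ (meeting C {x}).ncard
    · exact Or.inl (Set.eq_of_subset_of_ncard_le hsub (h.ncard_meeting ▸ h2) (Set.toFinite _))
    · have h1 := (isPartialTransversal_singleton hC x).ncard_le
      rw [Set.ncard_singleton] at h1
      exact Or.inr (Set.ncard_eq_one.1 (by omega))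
  rcases key a (by simp) with ha | ⟨K₁, ha⟩
  · exact Or.inl ha
  rcases key b (by simp) with hb | ⟨K₂, hb⟩
  · exact Or.inr (Or.inl hb)
  rcases key c (by simp) with hc | ⟨K₃, hc⟩
  · exact Or.inr (Or.inr hc)
  have h12 : K₁ ≠ K₂ := by
    rintro rfl
    exact meeting_ne_of_isPartialTransversal h.ne₁₂ h.indep₁₂ ha hb
  have h13 : K₁ ≠ K₃ := by
    rintro rfl
    exact meeting_ne_of_isPartialTransversal h.ne₁₃ h.indep₁₃ ha hc
  have h23 : K₂ ≠ K₃ := by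
    rintro rfl
    exact meeting_ne_of_isPartialTransversal h.ne₂₃ h.indep₂₃ hb hc
  have h2 := h.ncard_meeting
  have h3 : (meeting C {a, b, c}).ncard = 3 :=
    Set.ncard_eq_three.2 ⟨K₁, K₂, K₃, h12, h13, h23, by
      rw [meeting_insert, meeting_insert, ha, hb, hc]; rfl⟩
  omega

/-- If an element of a triangle meets every member of `C` that the triangle meets, then any
second triangle through it lies in the same line. -/
theorem IsTriangle.not_isPartialTransversal_of_meeting_eq {a b c d e : U}
    (h : IsTriangle C a b c) (h' : IsTriangle C a d e) (ha : meeting C {a} = meeting C {a, b, c})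
    (hbd : b ≠ d) : ¬ IsPartialTransversal C {a, b, d} := by
  intro hI
  have hle := hI.ncard_le
  rw [Set.ncard_eq_three.2 ⟨a, b, d, h.ne₁₂, h'.ne₁₂, hbd, rfl⟩] at hle
  -- `a` already meets two members, which is all that the second triangle can meet.
  have hade : meeting C {a} = meeting C {a, d, e} :=
    Set.eq_of_subset_of_ncard_le (meeting_mono C (by simp))
      (by rw [ha, h.ncard_meeting, h'.ncard_meeting]) (Set.toFinite _)
  have hsub : meeting C {a, b, d} ⊆ meeting C {a, b, c} := by
    rw [meeting_insert, meeting_insert]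
    refine Set.union_subset (meeting_mono C (by simp))
      (Set.union_subset (meeting_mono C (by simp)) ?_)
    rw [← ha, hade]
    exact meeting_mono C (by simp)
  have := Set.ncard_le_ncard hsub (Set.toFinite _)
  rw [h.ncard_meeting] at this
  omega

end Hall

/-! ### Partitions as equivalence relations, and their atoms. -/

section SetoidLattice

/-- The partition lattice of a finite set is the lattice of its equivalence relations. -/
noncomputable def setoidOrderIso (α : Type*) [Fintype α] [DecidableEq α] :
    Setoid α ≃o Finpartition (Finset.univ : Finset α) := by
  classical
  exact
  { toFun := fun s => Finpartition.ofSetoid s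
    invFun := fun p => Setoid.ker p.part
    left_inv := fun s => by
      ext a b
      rw [Setoid.ker_def, ← Finpartition.mem_part_iff_part_eq_part _ (Finset.mem_univ _)
        (Finset.mem_univ _), Finpartition.mem_part_ofSetoid_iff_rel]
      exact ⟨s.symm', s.symm'⟩
    right_inv := fun p => by
      have hpart : ∀ a, (Finpartition.ofSetoid (Setoid.ker p.part)).part a = p.part a := by
        intro a
        ext b
        rw [Finpartition.mem_part_ofSetoid_iff_rel, Setoid.ker_def,
          Finpartition.mem_part_iff_part_eq_part _ (Finset.mem_univ _) (Finset.mem_univ _)]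
        exact eq_comm
      have hmem : ∀ (q : Finpartition (Finset.univ : Finset α)) (t : Finset α),
          t ∈ q.parts ↔ ∃ a, q.part a = t := by
        intro q t
        constructor
        · intro ht
          obtain ⟨a, ha⟩ := q.nonempty_of_mem_parts ht
          exact ⟨a, q.part_eq_of_mem ht ha⟩
        · rintro ⟨a, rfl⟩
          exact q.part_mem.2 (Finset.mem_univ a)
      ext t
      rw [hmem, hmem]
      simp only [hpart]
    map_rel_iff' := by
      intro s t
      constructor
      · intro h a b hab
        obtain ⟨c, hc, hac⟩ := h ((Finpartition.ofSetoid s).part_mem.2 (Finset.mem_univ a))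
        have ha : a ∈ c := hac (Finpartition.mem_part_ofSetoid_iff_rel.2 (s.refl' a))
        have hb : b ∈ c := hac (Finpartition.mem_part_ofSetoid_iff_rel.2 hab)
        have hca : (Finpartition.ofSetoid t).part a = c := Finpartition.part_eq_of_mem _ hc ha
        rw [← hca] at hb
        exact Finpartition.mem_part_ofSetoid_iff_rel.1 hb
      · intro h b hb
        obtain ⟨a, ha⟩ := Finpartition.nonempty_of_mem_parts _ hb
        refine ⟨(Finpartition.ofSetoid t).part a, Finpartition.part_mem _ |>.2 (Finset.mem_univ a),
          fun x hx => ?_⟩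
        have hba : (Finpartition.ofSetoid s).part a = b := Finpartition.part_eq_of_mem _ hb ha
        rw [← hba] at hx
        exact Finpartition.mem_part_ofSetoid_iff_rel.2
          (h (Finpartition.mem_part_ofSetoid_iff_rel.1 hx)) }

/-- The equivalence relation whose only nontrivial class is `{i, j}`. -/
def pairSetoid {α : Type*} [DecidableEq α] (i j : α) : Setoid α :=
  Setoid.ker (Function.update id j i)

theorem pairSetoid_rel_iff {α : Type*} [DecidableEq α] {i j a b : α} :
    pairSetoid i j a b ↔ a = b ∨ (a = i ∧ b = j) ∨ (a = j ∧ b = i) := by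
  rw [pairSetoid, Setoid.ker_def, Function.update_apply, Function.update_apply]
  split_ifs <;> grind

theorem pairSetoid_le_iff {α : Type*} [DecidableEq α] {i j : α} {w : Setoid α} :
    pairSetoid i j ≤ w ↔ w i j := by
  constructor
  · exact fun h => h (pairSetoid_rel_iff.2 (by simp))
  · intro h a b hab
    rcases pairSetoid_rel_iff.1 hab with rfl | ⟨rfl, rfl⟩ | ⟨rfl, rfl⟩
    · exact w.refl' _
    · exact h
    · exact w.symm' h

theorem exists_rel_of_not_le_bot {α : Type*} {w : Setoid α} (h : ¬ w ≤ ⊥) :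
    ∃ i j, i ≠ j ∧ w i j := by
  by_contra! h'
  exact h fun a b hab => by_contra fun hne => h' a b hne hab

theorem eq_pairSetoid {α : Type*} [DecidableEq α] {i j : α} {w : Setoid α}
    (hw : w ≤ pairSetoid i j) (h : ¬ w ≤ ⊥) : w = pairSetoid i j := by
  refine le_antisymm hw (pairSetoid_le_iff.2 ?_)
  obtain ⟨a, b, hne, hab⟩ := exists_rel_of_not_le_bot h
  rcases pairSetoid_rel_iff.1 (hw hab) with rfl | ⟨rfl, rfl⟩ | ⟨rfl, rfl⟩
  · exact absurd rfl hne
  · exact hab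
  · exact w.symm' hab

end SetoidLattice

/-! ### Elements of `U` attached to pairs of points. -/

section Representation

variable {U α : Type*} [Finite U] {C : Set (Set U)} {φ : Setoid α ≃o L C}

theorem mem_closure_iff_setoid (φ : Setoid α ≃o L C) {X : Set U} {x : U} :
    x ∈ (transversalMatroid C).closure X ↔ ∀ w, X ⊆ (φ w).1 → x ∈ (φ w).1 := by
  rw [Matroid.mem_closure_iff_forall_mem_isFlat _ (Set.subset_univ X)]
  refine ⟨fun h w hw => h _ (φ w).2 hw, fun h F hF hXF => ?_⟩
  simpa using h (φ.symm ⟨F, hF⟩) (by simpa using hXF)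

/-- `x` lies in the rank-one flat of `M(C)` corresponding to the pair `i, j`. -/
def Represents (φ : Setoid α ≃o L C) (x : U) (i j : α) : Prop :=
  ∀ w, x ∈ (φ w).1 ↔ w i j

theorem Represents.symm {x : U} {i j : α} (h : Represents φ x i j) : Represents φ x j i :=
  fun w => (h w).trans ⟨w.symm', w.symm'⟩

theorem exists_represents (φ : Setoid α ≃o L C) {i j : α} (hij : i ≠ j) :
    ∃ x, Represents φ x i j := by
  classical
  have hlt : ¬ pairSetoid i j ≤ ⊥ := fun h => hij (pairSetoid_le_iff.1 h)
  rw [← φ.le_iff_le] at hlt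
  -- The closure of such an `x` pulls back to a nontrivial relation below an atom, hence to the atom
  -- itself.
  obtain ⟨x, hx, hx'⟩ := Set.not_subset.1 hlt
  refine ⟨x, fun w => ?_⟩
  let F : L C := ⟨(transversalMatroid C).closure {x}, Matroid.isFlat_closure _⟩
  have hF : ∀ G : L C, F ≤ G ↔ x ∈ G.1 := fun G =>
    ⟨fun h => h (Matroid.mem_closure_of_mem _ rfl (Set.subset_univ _)),
      fun h => ((transversalMatroid C).closure_subset_closure
        (Set.singleton_subset_iff.2 h)).trans_eq G.2.closure⟩
  have h1 : φ.symm F = pairSetoid i j := by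
    refine eq_pairSetoid ?_ ?_
    · rw [φ.symm_apply_le, hF]
      exact hx
    · rw [φ.symm_apply_le, hF]
      exact hx'
  rw [← hF, ← φ.symm_apply_le, h1, pairSetoid_le_iff]

theorem isPartialTransversal_insert {I : Set U} (hI : IsPartialTransversal C I) {x : U}
    (w : Setoid α) (hIw : I ⊆ (φ w).1) (hx : x ∉ (φ w).1) :
    IsPartialTransversal C (insert x I) := by
  rw [← transversalMatroid_indep_iff] at hI ⊢
  exact ((hI.notMem_closure_iff (Set.mem_univ x)).1
    fun h => hx ((mem_closure_iff_setoid φ).1 h w hIw)).1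

theorem Represents.isPartialTransversal_pair (hC : IsCovering C) {a b : U} {i j k : α}
    (ha : Represents φ a i j) (hb : Represents φ b i k) (hik : i ≠ k) (hjk : j ≠ k) :
    a ≠ b ∧ IsPartialTransversal C {a, b} := by
  -- The relation isolating `k` gives a flat containing `a` but not `b`.
  have haw : a ∈ (φ (Setoid.ker (· = k))).1 := by rw [ha, Setoid.ker_def]; simp [hik, hjk]
  have hbw : b ∉ (φ (Setoid.ker (· = k))).1 := by rw [hb, Setoid.ker_def]; simp [hik]
  refine ⟨fun h => hbw (h ▸ haw), ?_⟩
  rw [Set.pair_comm]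
  exact isPartialTransversal_insert (isPartialTransversal_singleton hC a) _
    (Set.singleton_subset_iff.2 haw) hbw

theorem Represents.isPartialTransversal_star (hC : IsCovering C) {a b d : U} {i j k l : α}
    (ha : Represents φ a i j) (hb : Represents φ b i k) (hd : Represents φ d i l)
    (hik : i ≠ k) (hjk : j ≠ k) (hil : i ≠ l) (hjl : j ≠ l) (hkl : k ≠ l) :
    IsPartialTransversal C {a, b, d} := by
  have haw : a ∈ (φ (Setoid.ker (· = l))).1 := by rw [ha, Setoid.ker_def]; simp [hil, hjl]
  have hbw : b ∈ (φ (Setoid.ker (· = l))).1 := by rw [hb, Setoid.ker_def]; simp [hil, hkl]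
  have hdw : d ∉ (φ (Setoid.ker (· = l))).1 := by rw [hd, Setoid.ker_def]; simp [hil]
  have := isPartialTransversal_insert (ha.isPartialTransversal_pair hC hb hik hjk).2 _
    (Set.insert_subset haw (Set.singleton_subset_iff.2 hbw)) hdw
  exact this.subset (by intro; simp; tauto)

theorem Represents.isTriangle (hC : IsCovering C) {a b c : U} {i j k : α}
    (ha : Represents φ a i j) (hb : Represents φ b i k) (hc : Represents φ c j k)
    (hij : i ≠ j) (hik : i ≠ k) (hjk : j ≠ k) : IsTriangle C a b c := by
  obtain ⟨hab, hIab⟩ := ha.isPartialTransversal_pair hC hb hik hjk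
  obtain ⟨hac, hIac⟩ := ha.symm.isPartialTransversal_pair hC hc hjk hik
  obtain ⟨hbc, hIbc⟩ := hb.symm.isPartialTransversal_pair hC hc.symm hjk.symm hij
  refine ⟨hab, hac, hbc, hIab, hIac, hIbc, fun h => ?_⟩
  have hmem : c ∈ (transversalMatroid C).closure {a, b} :=
    (mem_closure_iff_setoid φ).2 fun w hw =>
      (hc w).2 (w.trans' (w.symm' ((ha w).1 (hw (by simp)))) ((hb w).1 (hw (by simp))))
  refine (((transversalMatroid_indep_iff C _).2 hIab).notMem_closure_iff (Set.mem_univ c)).2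
    ⟨(transversalMatroid_indep_iff C _).2 (h.subset (by intro; simp; tauto)), ?_⟩ hmem
  simp [hac.symm, hbc.symm]

/-- The fourth point `l` puts a second triangle through `a`, forcing dependence of an independent
star. -/
theorem Represents.meeting_ne (hC : IsCovering C) {a b c : U} {i j k l : α}
    (ha : Represents φ a i j) (hb : Represents φ b i k) (hc : Represents φ c j k)
    (hij : i ≠ j) (hik : i ≠ k) (hjk : j ≠ k) (hil : i ≠ l) (hjl : j ≠ l) (hkl : k ≠ l) :
    meeting C {a} ≠ meeting C {a, b, c} := by
  intro h
  obtain ⟨d, hd⟩ := exists_represents φ hil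
  obtain ⟨e, he⟩ := exists_represents φ hjl
  exact (ha.isTriangle hC hb hc hij hik hjk).not_isPartialTransversal_of_meeting_eq
    (ha.isTriangle hC hd he hij hil hjl) h (hb.isPartialTransversal_pair hC hd hil hkl).1
    (ha.isPartialTransversal_star hC hb hd hik hjk hil hjl hkl)

theorem not_four_distinct (hC : IsCovering C) (φ : Setoid α ≃o L C) {i j k l : α}
    (hij : i ≠ j) (hik : i ≠ k) (hjk : j ≠ k) (hil : i ≠ l) (hjl : j ≠ l) (hkl : k ≠ l) :
    False := by
  obtain ⟨a, ha⟩ := exists_represents φ hij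
  obtain ⟨b, hb⟩ := exists_represents φ hik
  obtain ⟨c, hc⟩ := exists_represents φ hjk
  rcases (ha.isTriangle hC hb hc hij hik hjk).exists_meeting_eq hC with h | h | h
  · exact ha.meeting_ne hC hb hc hij hik hjk hil hjl hkl h
  · refine hb.meeting_ne hC ha hc.symm hik hij hjk.symm hil hkl hjl (h.trans ?_)
    rw [Set.insert_comm]
  · refine hc.meeting_ne hC ha.symm hb.symm hjk hij.symm hik.symm hjl hkl hil (h.trans ?_)
    rw [Set.pair_comm b c, Set.insert_comm]

/-- In a reduced covering every element represents a pair. -/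
theorem exists_eq_of_represents (hC : IsCovering C) (hred : IsReduced C) (φ : Setoid α ≃o L C)
    (x : U) : ∃ i j, i ≠ j ∧ ∀ a, Represents φ a i j → x = a := by
  let F : L C := ⟨(transversalMatroid C).closure {x}, Matroid.isFlat_closure _⟩
  -- `x` is not a loop, so it lies outside the closure of `∅`.
  have hF : ¬ φ.symm F ≤ ⊥ := by
    intro h
    have hx : x ∈ (transversalMatroid C).closure ∅ :=
      (mem_closure_iff_setoid φ).2 fun w _ =>
        (φ.symm_apply_le.1 (h.trans bot_le) : F ≤ φ w)
          (Matroid.mem_closure_of_mem _ rfl (Set.subset_univ _))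
    refine ((Matroid.empty_indep _).notMem_closure_iff (Set.mem_univ x)).2
      ⟨(transversalMatroid_indep_iff C _).2 ?_, by simp⟩ hx
    simpa using isPartialTransversal_singleton hC x
  obtain ⟨i, j, hij, hw⟩ := exists_rel_of_not_le_bot hF
  refine ⟨i, j, hij, fun a ha => ?_⟩
  have haF : a ∈ (transversalMatroid C).closure {x} := by
    have := (ha _).2 hw
    rwa [φ.apply_symm_apply] at this
  by_cases hax : x = a
  · exact hax
  -- `a` lies in the closure of `x`, so the two are parallel and reducedness applies.
  refine hred _ _ (sim_of_not_isPartialTransversal hC fun h => ?_)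
  refine (((transversalMatroid_indep_iff C _).2
    (isPartialTransversal_singleton hC x)).notMem_closure_iff (Set.mem_univ a)).2
    ⟨(transversalMatroid_indep_iff C _).2 (Set.pair_comm x a ▸ h), ?_⟩ haF
  exact fun h => hax h.symm

end Representation

/-! ### The family `familyE C` when `U` is a triangle, and the conclusion. -/

theorem IsTriangle.familyE_eq {U : Type*} [Finite U] {C : Set (Set U)} (hC : IsCovering C)
    {a b c : U} (h : IsTriangle C a b c) (huniv : ({a, b, c} : Set U) = Set.univ) :
    familyE C = {Set.univ} := by
  have hcard : (meeting C Set.univ).ncard = 2 := huniv ▸ h.ncard_meeting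
  have hE : ∀ x, meeting C {x} = meeting C Set.univ → E C x = Set.univ := fun x hx =>
    Set.eq_univ_of_forall fun y => show meeting C {y} ⊆ meeting C {x} from
      hx ▸ meeting_mono C (Set.subset_univ _)
  have hex : ∃ x, meeting C {x} = meeting C Set.univ := by
    rw [← huniv]
    rcases h.exists_meeting_eq hC with h | h | h
    exacts [⟨_, h⟩, ⟨_, h⟩, ⟨_, h⟩]
  apply Set.Subset.antisymm
  · rintro S ⟨x, hx, rfl⟩
    exact hE x (Set.eq_of_subset_of_ncard_le (meeting_mono C (Set.subset_univ _))
      (by rw [hx, hcard]) (Set.toFinite _))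
  · rintro _ rfl
    obtain ⟨x, hx⟩ := hex
    exact ⟨x, by rw [hx, hcard], (hE x hx).symm⟩

end CoveringLattice

theorem mainTheorem3 {U : Type*} [Finite U] (C : Set (Set U))
    (hC : CoveringLattice.IsCovering C) (n : ℕ)
    (hiso : Nonempty (CoveringLattice.P n ≃o CoveringLattice.L C)) :
    n ≤ 3 ∧
    (n = 3 → CoveringLattice.IsReduced C →
      Nat.card U = 3 ∧
      Setoid.IsPartition (CoveringLattice.familyE C) ∧
      (CoveringLattice.familyE C).ncard = 1) := by
  open CoveringLattice in
  obtain ⟨ψ⟩ := hiso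
  let φ : Setoid (Fin n) ≃o L C := (setoidOrderIso (Fin n)).trans ψ
  constructor
  · by_contra! hn
    exact not_four_distinct hC φ (i := ⟨0, by omega⟩) (j := ⟨1, by omega⟩) (k := ⟨2, by omega⟩)
      (l := ⟨3, by omega⟩) (by simp) (by simp) (by simp) (by simp) (by simp) (by simp)
  · rintro rfl hred
    obtain ⟨a, ha⟩ := exists_represents φ (i := 0) (j := 1) (by decide)
    obtain ⟨b, hb⟩ := exists_represents φ (i := 0) (j := 2) (by decide)
    obtain ⟨c, hc⟩ := exists_represents φ (i := 1) (j := 2) (by decide)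
    have htri := ha.isTriangle hC hb hc (by decide) (by decide) (by decide)
    have huniv : ({a, b, c} : Set U) = Set.univ := by
      refine Set.eq_univ_of_forall fun x => ?_
      obtain ⟨i, j, hij, hx⟩ := exists_eq_of_represents hC hred φ x
      have ha' := hx a
      have hb' := hx b
      have hc' := hx c
      fin_cases i <;> fin_cases j
      · exact absurd rfl hij
      · exact Or.inl (ha' ha)
      · exact Or.inr (Or.inl (hb' hb))
      · exact Or.inl (ha' ha.symm)
      · exact absurd rfl hij
      · exact Or.inr (Or.inr (hc' hc))
      · exact Or.inr (Or.inl (hb' hb.symm))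
      · exact Or.inr (Or.inr (hc' hc.symm))
      · exact absurd rfl hij
    have hfam := htri.familyE_eq hC huniv
    refine ⟨?_, ?_, ?_⟩
    · rw [← Set.ncard_univ, ← huniv]
      exact Set.ncard_eq_three.2 ⟨a, b, c, htri.ne₁₂, htri.ne₁₃, htri.ne₂₃, rfl⟩
    · rw [hfam]
      refine ⟨fun h => ?_, fun x => ⟨Set.univ, ⟨rfl, trivial⟩, fun S hS => hS.1⟩⟩
      exact (Set.notMem_empty a) ((show (∅ : Set U) = Set.univ from h) ▸ Set.mem_univ a)
    · rw [hfam, Set.ncard_singleton]
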